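/- For $z,v\in\mathbb{C}$ with $|z|\le 1$ and $v\ne 0,-1,-2,\dots$, let $\Phi(z,s,v)$ be the Hurwitz–Lerch zeta function: the analytic continuation in $s$ (to all $s\in\mathbb{C}$ if $z\ne 1$, to all $s\neq 1$ if $z=1$) of the series $\sum_{k=0}^{\infty} z^k (v+k)^{-s}$, $\operatorname{Re}s>1$. Let $$A=\lim_{N\to\infty}\frac{\prod_{k=1}^{N}k^k}{N^{N^2/2+N/2+1/12}\,e^{-N^2/4}}$$ be the Glaisher–Kinkelin constant. Then for every positive integer $n$ the functions $s\mapsto\Phi\left(-e^{2\pi i j/(2n+1)},s,n+1\right)$, $0\le j\le 2n$, are differentiable at $s=-1$, and $$\sum_{j=0}^{2n}(-1)^j e^{\frac{i\pi j}{2n+1}}\,\frac{\partial\Phi}{\partial s}\left(-e^{\frac{2\pi i j}{2n+1}},-1,n+1\right)=\frac{1}{8}(-1)^n(2n+1)^2\log\left(\frac{A^{24}}{4\cdot 2^{2/3}\,e^2\,(2n+1)^2}\right).$$ -/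

import Mathlib

open Complex Filter Topology

/-- The region of the variable `s` on which `s ↦ Φ(z, s, v)` is holomorphic: the whole plane if
`z ≠ 1`, and the plane without the pole `s = 1` if `z = 1`. -/
def lerchRegion (z : ℂ) : Set ℂ := {s | z = 1 → s ≠ 1}

/-- `F` is the analytic continuation in `s` of the Lerch series `∑ k, z ^ k (v + k) ^ (-s)`: it is
holomorphic on the region above and is the sum of the series in the half-plane `Re s > 1`. -/
def IsLerchContinuation (z v : ℂ) (F : ℂ → ℂ) : Prop :=
  DifferentiableOn ℂ F (lerchRegion z) ∧
    ∀ s : ℂ, 1 < s.re → HasSum (fun k : ℕ => z ^ k * (v + k) ^ (-s)) (F s)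

open Classical in
/-- The Hurwitz-Lerch zeta function `Φ(z, s, v)`, for `|z| ≤ 1` and `v ≠ 0, -1, -2, …`: the analytic
continuation in `s` of the Lerch series. (If there is no such continuation the value is `0`.) -/
noncomputable def lerchPhi (z s v : ℂ) : ℂ :=
  if h : ∃ F : ℂ → ℂ, IsLerchContinuation z v F then Classical.choose h s else 0

/-- The continuation is unique, so the choice in the definition does not matter. -/
theorem lerchPhi_eq_of_isLerchContinuation {z v : ℂ} {F : ℂ → ℂ} (hF : IsLerchContinuation z v F)
    {s : ℂ} (hs : s ∈ lerchRegion z) : lerchPhi z s v = F s := by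
  have h : ∃ F : ℂ → ℂ, IsLerchContinuation z v F := ⟨F, hF⟩
  have hG := Classical.choose_spec h
  have hval : lerchPhi z s v = Classical.choose h s := by
    unfold lerchPhi
    rw [dif_pos h]
  rw [hval]
  have hopen : IsOpen (lerchRegion z) := by
    by_cases hz : z = 1
    · have : lerchRegion z = {1}ᶜ := by ext; simp [lerchRegion, hz]
      rw [this]; exact isOpen_compl_singleton
    · have : lerchRegion z = Set.univ := by ext; simp [lerchRegion, hz]
      rw [this]; exact isOpen_univ
  have hconn : IsPreconnected (lerchRegion z) := by
    by_cases hz : z = 1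
    · have : lerchRegion z = {1}ᶜ := by ext; simp [lerchRegion, hz]
      rw [this]
      exact (isConnected_compl_singleton_of_one_lt_rank (by simp) _).isPreconnected
    · have : lerchRegion z = Set.univ := by ext; simp [lerchRegion, hz]
      rw [this]; exact isPreconnected_univ
  have h2 : (2 : ℂ) ∈ lerchRegion z := fun _ => by norm_num
  refine (hG.1.analyticOnNhd hopen).eqOn_of_preconnected_of_eventuallyEq
    (hF.1.analyticOnNhd hopen) hconn h2 ?_ hs
  have hU : {s : ℂ | 1 < s.re} ∈ 𝓝 (2 : ℂ) :=
    (isOpen_lt continuous_const continuous_re).mem_nhds (by simp)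
  filter_upwards [hU] with t ht
  exact (hG.2 t ht).unique (hF.2 t ht)

/-- The Glaisher-Kinkelin constant
`A = lim_{N → ∞} (1¹ 2² ⋯ Nᴺ) / (N ^ (N² / 2 + N / 2 + 1 / 12) * e ^ (-N² / 4)) = 1.2824…`. -/
noncomputable def glaisherA : ℝ :=
  limUnder atTop fun N : ℕ =>
    (∏ k ∈ Finset.Icc 1 N, (k : ℝ) ^ k) /
      ((N : ℝ) ^ ((N : ℝ) ^ 2 / 2 + (N : ℝ) / 2 + 1 / 12) * Real.exp (-(N : ℝ) ^ 2 / 4))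

/-! Put `m = 2n + 1` and `ω_j = e^{2πij/m}`. Since `m + 1 = 2(n + 1)`, the weight `(-1)^j e^{iπj/m}`
equals `ω_j^{n+1}`, so for `Re s > 1` summing over `j` keeps only the terms whose base `N = k + n +
1` is a multiple of `m`. All positive multiples of `m` exceed `n`, so none is lost, and the sum is
`(-1)^n m^{1-s} (1 - 2^{1-s}) ζ(s)` (`sum_lerchPhi_of_one_lt_re`). The identity theorem extends this
to `s ≠ 1` (`sum_lerchPhi`), and it is differentiated at `-1`.

This needs `ζ(-1) = -1/12` and `ζ'(-1) = 1/12 - log A`. For the latter, Euler-Maclaurin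
approximations converge to `ζ` uniformly on a region containing `-1`; their derivatives there are
`1/12` minus the logarithms of the quotients defining `A`. -/

/-! ### Euler-Maclaurin approximation of `ζ` near `-1` -/

/-- The boundary terms of the Euler-Maclaurin formula for `∑ k, k ^ (-s)`. -/
noncomputable def zetaCorrection (x : ℝ) (s : ℂ) : ℂ :=
  -((x : ℂ) ^ (1 - s) / (1 - s)) - (x : ℂ) ^ (-s) / 2 + s * (x : ℂ) ^ (-s - 1) / 12

/-- The increments of the Euler-Maclaurin approximations to `ζ(s)`. -/
noncomputable def zetaIncrement (k : ℕ) (s : ℂ) : ℂ :=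
  ((k + 1 + 1 : ℝ) : ℂ) ^ (-s) + (zetaCorrection (k + 1 + 1) s - zetaCorrection (k + 1) s)

/-- A convex region on which the Euler-Maclaurin approximations converge uniformly to `ζ`. -/
def zetaDomain : Set ℂ := {s | s.re - s.im < 1} ∩ Metric.ball 1 (5 / 2)

theorem isOpen_zetaDomain : IsOpen zetaDomain :=
  (isOpen_lt (by fun_prop) continuous_const).inter Metric.isOpen_ball

theorem convex_zetaDomain : Convex ℝ zetaDomain :=
  (convex_halfSpace_lt (f := fun s : ℂ => s.re - s.im)
    ((reLm - imLm : ℂ →ₗ[ℝ] ℝ).isLinear) 1).inter (convex_ball _ _)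

theorem neg_one_mem_zetaDomain : (-1 : ℂ) ∈ zetaDomain := by
  refine ⟨by simp, ?_⟩
  rw [Metric.mem_ball, dist_eq]
  norm_num

theorem ne_one_of_mem_zetaDomain {s : ℂ} (hs : s ∈ zetaDomain) : s ≠ 1 := by
  rintro rfl
  simpa using hs.1

theorem hasDerivAt_ofReal_cpow {x : ℝ} (hx : 0 < x) (c : ℂ) :
    HasDerivAt (fun y : ℝ => (y : ℂ) ^ c) (c * (x : ℂ) ^ (c - 1)) x := by
  have h : HasDerivAt (fun w : ℂ => w ^ c) (c * (x : ℂ) ^ (c - 1)) x := by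
    simpa using (hasDerivAt_id (x : ℂ)).cpow_const (c := c) (Or.inl (by simpa using hx))
  exact h.comp_ofReal

/-- The cubic Bernoulli polynomial gives an antiderivative for the Euler-Maclaurin remainder. -/
theorem hasDerivAt_eulerMaclaurin (a : ℝ) {x : ℝ} (hx : 0 < x) {s : ℂ} (hs : s ≠ 1) :
    HasDerivAt (fun y : ℝ =>
      ((y - a : ℂ) ^ 3 - 3 / 2 * (y - a : ℂ) ^ 2 + (y - a : ℂ) / 2) / 6 *
          (s * (s + 1) * (y : ℂ) ^ (-s - 2))
        + (3 * (y - a : ℂ) ^ 2 - 3 * (y - a : ℂ) + 1 / 2) / 6 * (s * (y : ℂ) ^ (-s - 1))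
        + ((y - a : ℂ) - 1 / 2) * (y : ℂ) ^ (-s) - (y : ℂ) ^ (1 - s) / (1 - s))
      (-(((x - a : ℂ) ^ 3 - 3 / 2 * (x - a : ℂ) ^ 2 + (x - a : ℂ) / 2) / 6 *
          (s * (s + 1) * (s + 2) * (x : ℂ) ^ (-s - 3)))) x := by
  have h1 : (1 - s) ≠ 0 := sub_ne_zero.mpr hs.symm
  have ht : HasDerivAt (fun y : ℝ => (y - a : ℂ)) 1 x := by
    simpa using (hasDerivAt_id x).ofReal_comp.sub_const (a : ℂ)
  have e2 := hasDerivAt_ofReal_cpow hx (-s - 2)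
  have e1 := hasDerivAt_ofReal_cpow hx (-s - 1)
  have e0 := hasDerivAt_ofReal_cpow hx (-s)
  have e := hasDerivAt_ofReal_cpow hx (1 - s)
  rw [show -s - 2 - 1 = -s - 3 by ring] at e2
  rw [show -s - 1 - 1 = -s - 2 by ring] at e1
  rw [show 1 - s - 1 = -s by ring] at e
  have hp3 := ((((ht.fun_pow 3).sub ((ht.fun_pow 2).const_mul (3 / 2 : ℂ))).add
    (ht.div_const 2)).div_const 6).mul (e2.const_mul (s * (s + 1)))
  have hp2 := (((((ht.fun_pow 2).const_mul (3 : ℂ)).sub (ht.const_mul (3 : ℂ))).add_const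
    (1 / 2 : ℂ)).div_const 6).mul (e1.const_mul s)
  have hp1 := (ht.sub_const (1 / 2 : ℂ)).mul e0
  -- Each polynomial coefficient differentiates to the next one, so everything cancels except the
  -- term with `y ^ (-s - 3)`.
  refine (((hp3.add hp2).add hp1).sub (e.div_const (1 - s))).congr_deriv ?_
  simp only [Pi.add_apply, Pi.sub_apply]
  rw [mul_div_cancel_left₀ _ h1]
  push_cast
  ring

/-- Mean value inequality on `[a, a + 1]` for the function in `hasDerivAt_eulerMaclaurin`. The
radius `5/2` gives `Re s ≥ -3/2`, hence the summable exponent `-3/2`; the constant is `7/2 · 9/2 ·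
11/2 < 100`. -/
theorem norm_zetaIncrement_le (k : ℕ) {s : ℂ} (hs : s ∈ zetaDomain) :
    ‖zetaIncrement k s‖ ≤ 100 * ((k + 1 : ℕ) : ℝ) ^ (-(3 / 2) : ℝ) := by
  set a : ℝ := k + 1 with ha
  have ha1 : 1 ≤ a := by simp [ha]
  have hball : ‖s - 1‖ < 5 / 2 := by simpa [dist_eq] using hs.2
  have hre : -(3 / 2) ≤ s.re := by
    have := (abs_le.mp (abs_re_le_norm (s - 1))).1
    simp only [sub_re, one_re] at this
    linarith
  have n0 : ‖s‖ ≤ 7 / 2 := by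
    have := norm_add_le (s - 1) 1
    simp only [sub_add_cancel, norm_one] at this
    linarith
  have n1 : ‖s + 1‖ ≤ 9 / 2 := (norm_add_le _ _).trans (by simp; linarith)
  have n2 : ‖s + 2‖ ≤ 11 / 2 := (norm_add_le _ _).trans (by simp; linarith)
  have key := norm_image_sub_le_of_norm_deriv_le_segment' (a := a) (b := a + 1)
    (C := 100 * a ^ (-(3 / 2) : ℝ))
    (fun x hx => (hasDerivAt_eulerMaclaurin a (by linarith [hx.1])
      (ne_one_of_mem_zetaDomain hs)).hasDerivWithinAt) (fun x hx => by
        have hx1 : 1 ≤ x := ha1.trans hx.1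
        have hx0 : 0 < x := by linarith
        have hcast : (x - a : ℂ) = ((x - a : ℝ) : ℂ) := by push_cast; rfl
        have ht0 : 0 ≤ x - a := by linarith [hx.1]
        have ht1 : x - a ≤ 1 := by linarith [hx.2]
        have hp : ‖((x - a : ℂ) ^ 3 - 3 / 2 * (x - a : ℂ) ^ 2 + (x - a : ℂ) / 2) / 6‖ ≤ 1 := by
          rw [hcast]
          have : (((x - a : ℝ) : ℂ) ^ 3 - 3 / 2 * ((x - a : ℝ) : ℂ) ^ 2 + ((x - a : ℝ) : ℂ) / 2) / 6
              = ((((x - a) ^ 3 - 3 / 2 * (x - a) ^ 2 + (x - a) / 2) / 6 : ℝ) : ℂ) := by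
            push_cast; ring
          rw [this, norm_real, Real.norm_eq_abs, abs_le]
          have h2 : (x - a) ^ 2 ≤ 1 := pow_le_one₀ ht0 ht1
          have h3 : (x - a) ^ 3 ≤ 1 := pow_le_one₀ ht0 ht1
          have h2' : 0 ≤ (x - a) ^ 2 := by positivity
          have h3' : 0 ≤ (x - a) ^ 3 := by positivity
          constructor <;> linarith
        have hx3 : ‖(x : ℂ) ^ (-s - 3)‖ ≤ a ^ (-(3 / 2) : ℝ) := by
          rw [norm_cpow_eq_rpow_re_of_pos hx0]
          calc x ^ (-s - 3).re ≤ x ^ (-(3 / 2) : ℝ) :=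
                Real.rpow_le_rpow_of_exponent_le hx1 (by simp; linarith)
            _ ≤ a ^ (-(3 / 2) : ℝ) :=
                Real.rpow_le_rpow_of_nonpos (by linarith) hx.1 (by norm_num)
        rw [norm_neg, norm_mul]
        calc _ ≤ 1 * ‖s * (s + 1) * (s + 2) * (x : ℂ) ^ (-s - 3)‖ := by gcongr
          _ = ‖s‖ * ‖s + 1‖ * ‖s + 2‖ * ‖(x : ℂ) ^ (-s - 3)‖ := by simp
          _ ≤ (7 / 2) * (9 / 2) * (11 / 2) * a ^ (-(3 / 2) : ℝ) := by gcongr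
          _ ≤ 100 * a ^ (-(3 / 2) : ℝ) := by gcongr; norm_num)
    (a + 1) ⟨by linarith, le_rfl⟩
  rw [add_sub_cancel_left, mul_one] at key
  have hcast : (((k + 1 : ℕ) : ℝ)) = a := by simp [ha]
  rw [hcast]
  -- The cubic vanishes at both ends, the quadratic term has coefficient `1/12` at both, and the
  -- linear one jumps from `-1/2` to `1/2`; this jump supplies the summand `(a + 1) ^ (-s)`.
  refine (le_of_eq ?_).trans key
  congr 1
  simp only [zetaIncrement, zetaCorrection, ← ha]
  push_cast
  ring

theorem differentiableAt_zetaCorrection {x : ℝ} (hx : 0 < x) {s : ℂ} (hs : s ≠ 1) :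
    DifferentiableAt ℂ (zetaCorrection x) s := by
  have h1 : (1 - s) ≠ 0 := sub_ne_zero.mpr hs.symm
  have hx' : (x : ℂ) ≠ 0 := by exact_mod_cast hx.ne'
  unfold zetaCorrection
  fun_prop (disch := first | assumption | exact Or.inl hx')

theorem differentiableAt_zetaIncrement (k : ℕ) {s : ℂ} (hs : s ≠ 1) :
    DifferentiableAt ℂ (zetaIncrement k) s := by
  have hk : ((k + 1 + 1 : ℝ) : ℂ) ≠ 0 := by
    exact_mod_cast (by positivity : (k + 1 + 1 : ℝ) ≠ 0)
  refine DifferentiableAt.add ?_ ((differentiableAt_zetaCorrection (by positivity) hs).sub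
    (differentiableAt_zetaCorrection (by positivity) hs))
  exact (differentiableAt_id.neg).const_cpow (Or.inl hk)

theorem summable_zetaIncrement_bound :
    Summable fun k : ℕ => 100 * ((k + 1 : ℕ) : ℝ) ^ (-(3 / 2) : ℝ) :=
  ((summable_nat_add_iff (f := fun k : ℕ => (k : ℝ) ^ (-(3 / 2) : ℝ)) 1).mpr
    (Real.summable_nat_rpow.mpr (by norm_num))).mul_left 100

theorem sum_range_zetaIncrement (K : ℕ) (s : ℂ) :
    1 + zetaCorrection 1 s + ∑ k ∈ Finset.range K, zetaIncrement k s =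
      ∑ k ∈ Finset.range (K + 1), ((k + 1 : ℝ) : ℂ) ^ (-s) + zetaCorrection (K + 1) s := by
  induction K with
  | zero => simp
  | succ K ih =>
    rw [Finset.sum_range_succ, ← add_assoc, ih, Finset.sum_range_succ _ (K + 1), zetaIncrement]
    push_cast
    ring

theorem tendsto_natCast_add_one_cpow_zero {c : ℂ} (hc : c.re < 0) :
    Tendsto (fun K : ℕ => ((K + 1 : ℝ) : ℂ) ^ c) atTop (𝓝 0) := by
  rw [tendsto_zero_iff_norm_tendsto_zero]
  have h : ∀ K : ℕ, ‖((K + 1 : ℝ) : ℂ) ^ c‖ = (K + 1 : ℝ) ^ (-(-c.re)) := fun K => by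
    rw [norm_cpow_eq_rpow_re_of_pos (by positivity), neg_neg]
  simp only [h]
  exact (tendsto_rpow_neg_atTop (by linarith)).comp
    (tendsto_atTop_add_const_right _ 1 tendsto_natCast_atTop_atTop)

theorem tendsto_zetaCorrection {s : ℂ} (hs : 1 < s.re) :
    Tendsto (fun K : ℕ => zetaCorrection (K + 1) s) atTop (𝓝 0) := by
  have h1 := tendsto_natCast_add_one_cpow_zero (c := 1 - s) (by simp; linarith)
  have h2 := tendsto_natCast_add_one_cpow_zero (c := -s) (by simp; linarith)
  have h3 := tendsto_natCast_add_one_cpow_zero (c := -s - 1) (by simp; linarith)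
  have := (((h1.div_const (1 - s)).neg).sub (h2.div_const 2)).add ((h3.const_mul s).div_const 12)
  simpa [zetaCorrection] using this

theorem riemannZeta_eq_tsum_zetaIncrement_of_one_lt_re {s : ℂ} (hs : s ∈ zetaDomain)
    (h1 : 1 < s.re) :
    riemannZeta s = 1 + zetaCorrection 1 s + ∑' k, zetaIncrement k s := by
  have hsum : Summable fun k => zetaIncrement k s :=
    Summable.of_norm_bounded summable_zetaIncrement_bound fun k => norm_zetaIncrement_le k hs
  have hl := hsum.hasSum.tendsto_sum_nat.const_add (1 + zetaCorrection 1 s)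
  simp only [sum_range_zetaIncrement] at hl
  have hz : HasSum (fun k : ℕ => ((k + 1 : ℝ) : ℂ) ^ (-s)) (riemannZeta s) := by
    have hs' : Summable fun k : ℕ => ((k + 1 : ℝ) : ℂ) ^ (-s) := by
      have := (summable_nat_add_iff 1).mpr (summable_one_div_nat_cpow.mpr h1)
      simpa [cpow_neg] using this
    rw [zeta_eq_tsum_one_div_nat_add_one_cpow h1]
    simpa [cpow_neg] using hs'.hasSum
  have hr := (hz.tendsto_sum_nat.comp (tendsto_add_atTop_nat 1)).add (tendsto_zetaCorrection h1)
  rw [add_zero] at hr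
  exact tendsto_nhds_unique hr hl

theorem differentiableOn_tsum_zetaIncrement :
    DifferentiableOn ℂ (fun s => 1 + zetaCorrection 1 s + ∑' k, zetaIncrement k s) zetaDomain := by
  refine DifferentiableOn.add (fun s hs => ?_) (differentiableOn_tsum_of_summable_norm
    summable_zetaIncrement_bound (fun k s hs => (differentiableAt_zetaIncrement k
      (ne_one_of_mem_zetaDomain hs)).differentiableWithinAt) isOpen_zetaDomain
    fun k s hs => norm_zetaIncrement_le k hs)
  exact ((differentiableAt_zetaCorrection one_pos
    (ne_one_of_mem_zetaDomain hs)).const_add 1).differentiableWithinAt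

/-- Identity theorem: the slanted edge of `zetaDomain` excludes the pole `1` but leaves `-1` and
points with `Re s > 1`, such as `3/2 + i`, in one convex set. -/
theorem riemannZeta_eqOn_tsum_zetaIncrement :
    Set.EqOn riemannZeta (fun s => 1 + zetaCorrection 1 s + ∑' k, zetaIncrement k s)
      zetaDomain := by
  have hp : (3 / 2 + I : ℂ) ∈ zetaDomain := by
    refine ⟨by norm_num, ?_⟩
    rw [Metric.mem_ball, dist_eq, show (3 / 2 + I - 1 : ℂ) = 1 / 2 + I by ring]
    refine (norm_add_le _ _).trans_lt ?_
    norm_num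
  refine AnalyticOnNhd.eqOn_of_preconnected_of_eventuallyEq
    (DifferentiableOn.analyticOnNhd (fun s hs => (differentiableAt_riemannZeta
      (ne_one_of_mem_zetaDomain hs)).differentiableWithinAt) isOpen_zetaDomain)
    (differentiableOn_tsum_zetaIncrement.analyticOnNhd isOpen_zetaDomain)
    convex_zetaDomain.isPreconnected hp ?_
  have hU : {s : ℂ | 1 < s.re} ∈ 𝓝 (3 / 2 + I : ℂ) :=
    (isOpen_lt continuous_const continuous_re).mem_nhds (by norm_num)
  filter_upwards [hU, isOpen_zetaDomain.mem_nhds hp] with s h1 hs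
  exact riemannZeta_eq_tsum_zetaIncrement_of_one_lt_re hs h1

/-! ### `ζ'(-1)` and the Glaisher-Kinkelin constant -/

theorem hasDerivAt_zetaCorrection_neg_one {x : ℝ} (hx : 0 < x) :
    HasDerivAt (zetaCorrection x)
      (((x ^ 2 / 2 + x / 2 + 1 / 12) * Real.log x - x ^ 2 / 4 + 1 / 12 : ℝ) : ℂ) (-1) := by
  have hx' : (x : ℂ) ≠ 0 := by exact_mod_cast hx.ne'
  have hid := hasDerivAt_id (-1 : ℂ)
  have a1 := (hid.const_sub 1).const_cpow (c := (x : ℂ)) (Or.inl hx')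
  have a0 := hid.neg.const_cpow (c := (x : ℂ)) (Or.inl hx')
  have a2 := (hid.neg.sub_const 1).const_cpow (c := (x : ℂ)) (Or.inl hx')
  have := (((a1.div (hid.const_sub 1) (by norm_num)).neg).sub (a0.div_const 2)).add
    ((hid.mul a2).div_const 12)
  refine this.congr_deriv ?_
  simp only [id, Pi.neg_apply, neg_neg, sub_neg_eq_add, sub_self, cpow_zero, cpow_one,
    show (1 + 1 : ℂ) = 2 by norm_num, cpow_ofNat, ← ofReal_log hx.le]
  push_cast
  ring

theorem hasDerivAt_natCast_cpow_neg_one (k : ℕ) :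
    HasDerivAt (fun s : ℂ => ((k + 1 : ℝ) : ℂ) ^ (-s))
      ((-((k + 1 : ℝ) * Real.log (k + 1)) : ℝ) : ℂ) (-1) := by
  have hk : ((k + 1 : ℝ) : ℂ) ≠ 0 := by exact_mod_cast (by positivity : (k + 1 : ℝ) ≠ 0)
  refine ((hasDerivAt_id (-1 : ℂ)).neg.const_cpow (Or.inl hk)).congr_deriv ?_
  simp only [id, Pi.neg_apply, neg_neg, cpow_one, ← ofReal_log (by positivity : (0 : ℝ) ≤ k + 1)]
  push_cast
  ring

theorem tendsto_deriv_riemannZeta_neg_one :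
    Tendsto (fun K : ℕ => (((∑ k ∈ Finset.range (K + 1), -((k + 1 : ℝ) * Real.log (k + 1))) +
      ((((K + 1 : ℝ)) ^ 2 / 2 + (K + 1 : ℝ) / 2 + 1 / 12) * Real.log (K + 1)
        - (K + 1 : ℝ) ^ 2 / 4 + 1 / 12) : ℝ) : ℂ)) atTop (𝓝 (deriv riemannZeta (-1))) := by
  have hne : (-1 : ℂ) ≠ 1 := by norm_num
  have hderiv : deriv riemannZeta (-1) = deriv (fun s => 1 + zetaCorrection 1 s) (-1) +
      deriv (fun s => ∑' k, zetaIncrement k s) (-1) := by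
    rw [(riemannZeta_eqOn_tsum_zetaIncrement.eventuallyEq_of_mem
      (isOpen_zetaDomain.mem_nhds neg_one_mem_zetaDomain)).deriv_eq]
    refine deriv_fun_add ((differentiableAt_zetaCorrection one_pos hne).const_add 1) ?_
    exact (differentiableOn_tsum_of_summable_norm summable_zetaIncrement_bound
      (fun k s hs => (differentiableAt_zetaIncrement k
        (ne_one_of_mem_zetaDomain hs)).differentiableWithinAt) isOpen_zetaDomain
      fun k s hs => norm_zetaIncrement_le k hs).differentiableAt
        (isOpen_zetaDomain.mem_nhds neg_one_mem_zetaDomain)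
  have hsum := (hasSum_deriv_of_summable_norm summable_zetaIncrement_bound
    (fun k s hs => (differentiableAt_zetaIncrement k
      (ne_one_of_mem_zetaDomain hs)).differentiableWithinAt) isOpen_zetaDomain
    (fun k s hs => norm_zetaIncrement_le k hs) neg_one_mem_zetaDomain).tendsto_sum_nat.const_add
      (deriv (fun s => 1 + zetaCorrection 1 s) (-1))
  rw [hderiv]
  refine hsum.congr fun K => ?_
  -- The partial sum is differentiated in both its telescoped and its untelescoped form, and the
  -- results are compared.
  have hL := ((differentiableAt_zetaCorrection one_pos hne).const_add 1).hasDerivAt.add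
    (HasDerivAt.fun_sum (u := Finset.range K) fun k _ =>
      (differentiableAt_zetaIncrement k hne).hasDerivAt)
  have hR := (HasDerivAt.fun_sum (u := Finset.range (K + 1)) fun k _ =>
    hasDerivAt_natCast_cpow_neg_one k).add
      (hasDerivAt_zetaCorrection_neg_one (x := K + 1) (by positivity))
  have hfun : (fun s : ℂ => 1 + zetaCorrection 1 s) +
      (fun s : ℂ => ∑ k ∈ Finset.range K, zetaIncrement k s) =
      (fun s : ℂ => ∑ k ∈ Finset.range (K + 1), ((k + 1 : ℝ) : ℂ) ^ (-s)) +
        zetaCorrection (K + 1 : ℝ) := by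
    funext s
    exact sum_range_zetaIncrement K s
  rw [hfun] at hL
  rw [hL.unique hR]
  push_cast
  rfl

/-- The limit defining the Glaisher-Kinkelin constant exists, and `ζ'(-1) = 1 / 12 - log A`. -/
theorem glaisherA_pos_and_deriv_riemannZeta_neg_one :
    0 < glaisherA ∧ deriv riemannZeta (-1) = ((1 / 12 - Real.log glaisherA : ℝ) : ℂ) := by
  have ht := tendsto_deriv_riemannZeta_neg_one
  have hre := (continuous_re.tendsto _).comp ht
  have him := (continuous_im.tendsto _).comp ht
  simp only [Function.comp_def, ofReal_re, ofReal_im] at hre him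
  -- A limit of real numbers is real.
  have hreal : deriv riemannZeta (-1) = ((deriv riemannZeta (-1)).re : ℂ) :=
    Complex.ext rfl (by simpa using (tendsto_nhds_unique him tendsto_const_nhds))
  set d := (deriv riemannZeta (-1)).re
  have hlim : Tendsto (fun N : ℕ => (∏ k ∈ Finset.Icc 1 N, (k : ℝ) ^ k) /
      ((N : ℝ) ^ ((N : ℝ) ^ 2 / 2 + (N : ℝ) / 2 + 1 / 12) * Real.exp (-(N : ℝ) ^ 2 / 4)))
      atTop (𝓝 (Real.exp (1 / 12 - d))) := by
    rw [← tendsto_add_atTop_iff_nat 1]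
    refine ((Real.continuous_exp.tendsto _).comp (hre.const_sub (1 / 12))).congr fun K => ?_
    have hprod : ∏ k ∈ Finset.Icc 1 (K + 1), (k : ℝ) ^ k =
        Real.exp (∑ k ∈ Finset.range (K + 1), (k + 1 : ℝ) * Real.log (k + 1)) := by
      clear * -
      induction K with
      | zero => simp
      | succ K ih =>
        rw [Finset.prod_Icc_succ_top (by omega), ih, Finset.sum_range_succ _ (K + 1), Real.exp_add,
          ← Nat.cast_succ (K + 1), mul_comm _ (Real.log _), Real.exp_mul,
          Real.exp_log (by positivity), Real.rpow_natCast]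
    rw [Function.comp_apply, hprod, Real.rpow_def_of_pos (by positivity), ← Real.exp_add,
      ← Real.exp_sub, Finset.sum_neg_distrib]
    congr 1
    push_cast
    ring
  have hA : glaisherA = Real.exp (1 / 12 - d) := hlim.limUnder_eq
  rw [hA, Real.log_exp, hreal]
  exact ⟨Real.exp_pos _, by simp⟩

/-! ### The Lerch function on the unit circle -/

open HurwitzZeta in
/-- At a point `z ≠ 1` of the unit circle the Lerch function with positive integral shift is an
exponential zeta function without its first terms. -/
theorem isLerchContinuation_exp (a : ℝ) (n : ℕ) (hz : cexp (2 * Real.pi * I * a) ≠ 1) :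
    IsLerchContinuation (cexp (2 * Real.pi * I * a)) (n + 1) fun s =>
      (cexp (2 * Real.pi * I * a) ^ (n + 1))⁻¹ * (expZeta a s -
        ∑ k ∈ Finset.range n, cexp (2 * Real.pi * I * a) ^ (k + 1) * (k + 1 : ℂ) ^ (-s)) := by
  constructor
  -- For `a` not an integer, `expZeta a` is entire.
  · have ha : (a : UnitAddCircle) ≠ 0 := by
      intro h
      obtain ⟨m, hm⟩ := (AddCircle.coe_eq_zero_iff (1 : ℝ)).mp h
      apply hz
      rw [← hm, exp_eq_one_iff]
      exact ⟨m, by simp; ring⟩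
    refine Differentiable.differentiableOn ?_
    refine ((differentiable_expZeta_of_ne_zero ha).sub
      (Differentiable.fun_sum fun k _ => ?_)).const_mul _
    exact (differentiable_id.neg.const_cpow (Or.inl (Nat.cast_add_one_ne_zero k))).const_mul _
  · intro s hs
    have hs0 : s ≠ 0 := ne_zero_of_one_lt_re hs
    have h := ((hasSum_nat_add_iff' (n + 1)).mpr (hasSum_expZeta_of_one_lt_re a hs)).mul_left
      (cexp (2 * Real.pi * I * a) ^ (n + 1))⁻¹
    have hpow (k : ℕ) : cexp (2 * Real.pi * I * a * k) = cexp (2 * Real.pi * I * a) ^ k := by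
      rw [← exp_nat_mul, mul_comm]
    simp only [hpow] at h
    -- The term of index `0` is a division by `0 ^ s = 0`, so it contributes `0`.
    rw [Finset.sum_range_succ', Nat.cast_zero, zero_cpow hs0, div_zero, add_zero] at h
    have hne : cexp (2 * Real.pi * I * a) ^ (n + 1) ≠ 0 := pow_ne_zero _ (exp_ne_zero _)
    simp only [cpow_neg, ← div_eq_mul_inv]
    push_cast at h
    refine h.congr_fun fun k => ?_
    rw [pow_add _ k, add_comm (k : ℂ)]
    field_simp

theorem differentiable_lerchPhi_exp (a : ℝ) (n : ℕ) (hz : cexp (2 * Real.pi * I * a) ≠ 1) :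
    Differentiable ℂ fun s => lerchPhi (cexp (2 * Real.pi * I * a)) s (n + 1) := by
  have hF := isLerchContinuation_exp a n hz
  have huniv : lerchRegion (cexp (2 * Real.pi * I * a)) = Set.univ := by
    ext s
    simp [lerchRegion, hz]
  have hd := hF.1
  rw [huniv, differentiableOn_univ] at hd
  convert! hd using 2 with s
  exact lerchPhi_eq_of_isLerchContinuation hF (by simp [huniv])

theorem hasSum_lerchPhi_exp (a : ℝ) (n : ℕ) (hz : cexp (2 * Real.pi * I * a) ≠ 1) {s : ℂ}
    (hs : 1 < s.re) :
    HasSum (fun k : ℕ => cexp (2 * Real.pi * I * a) ^ k * (n + 1 + k : ℂ) ^ (-s))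
      (lerchPhi (cexp (2 * Real.pi * I * a)) s (n + 1)) := by
  have hF := isLerchContinuation_exp a n hz
  rw [lerchPhi_eq_of_isLerchContinuation hF fun h => absurd h hz]
  exact hF.2 s hs

/-! ### Averaging over roots of unity -/

/-- The alternating zeta series. -/
theorem hasSum_neg_one_pow_mul_natCast_cpow {s : ℂ} (hs : 1 < s.re) :
    HasSum (fun l : ℕ => (-1 : ℂ) ^ l * (l : ℂ) ^ (-s)) (-((1 - 2 ^ (1 - s)) * riemannZeta s)) := by
  have hs0 : s ≠ 0 := ne_zero_of_one_lt_re hs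
  have hz : HasSum (fun l : ℕ => (l : ℂ) ^ (-s)) (riemannZeta s) := by
    have h := (summable_one_div_nat_cpow.mpr hs).hasSum
    rw [← zeta_eq_tsum_one_div_nat_cpow hs] at h
    simpa [cpow_neg] using h
  have hinj : Function.Injective fun l : ℕ => 2 * l := fun a b h => by simpa using h
  -- `(-1)^l + 1` is twice the indicator of the even numbers.
  have he : HasSum (fun l : ℕ => ((-1 : ℂ) ^ l + 1) * (l : ℂ) ^ (-s))
      (2 ^ (1 - s) * riemannZeta s) := by
    rw [← hinj.hasSum_iff]
    · refine (hz.mul_left ((2 : ℂ) ^ (1 - s))).congr_fun ?_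
      intro l
      simp only [Function.comp_apply]
      rw [Nat.cast_mul, natCast_mul_natCast_cpow, pow_mul, Nat.cast_ofNat, sub_eq_add_neg 1 s,
        cpow_add _ _ two_ne_zero, cpow_one]
      norm_num
      ring
    · intro l hl
      have : Odd l := by
        rw [← Nat.not_even_iff_odd]
        rintro ⟨r, rfl⟩
        exact hl ⟨r, by simp; ring⟩
      simp [this.neg_one_pow]
  rw [show -((1 - 2 ^ (1 - s)) * riemannZeta s) =
    2 ^ (1 - s) * riemannZeta s - riemannZeta s by ring]
  exact (he.sub hz).congr_fun fun l => by ring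

/-- Averaging over the `m`-th roots of unity selects the multiples of `m`. -/
theorem sum_range_exp_pow (m N : ℕ) (hm : m ≠ 0) :
    ∑ j ∈ Finset.range m, (cexp (2 * Real.pi * I * j / m)) ^ N = if m ∣ N then (m : ℂ) else 0 := by
  have hprim := isPrimitiveRoot_exp m hm
  have h (j : ℕ) : cexp (2 * Real.pi * I * j / m) ^ N = (cexp (2 * Real.pi * I / m) ^ N) ^ j := by
    rw [← exp_nat_mul, ← exp_nat_mul, ← exp_nat_mul]
    congr 1
    ring
  simp only [h]
  split_ifs with hd
  · rw [(hprim.pow_eq_one_iff_dvd N).mpr hd]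
    simp
  · have hne : cexp (2 * Real.pi * I / m) ^ N ≠ 1 := fun h => hd ((hprim.pow_eq_one_iff_dvd N).mp h)
    rw [geom_sum_eq hne, ← pow_mul, mul_comm N m, pow_mul, hprim.pow_eq_one, one_pow, sub_self,
      zero_div]

theorem neg_exp_eq_exp_add_half (n j : ℕ) :
    -cexp (2 * I * Real.pi * j / (2 * n + 1)) =
      cexp (2 * Real.pi * I * ((j / (2 * n + 1) + 1 / 2 : ℝ) : ℂ)) := by
  have : 2 * Real.pi * I * ((j / (2 * n + 1) + 1 / 2 : ℝ) : ℂ) =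
      2 * I * Real.pi * j / (2 * n + 1) + Real.pi * I := by
    push_cast
    ring
  rw [this, exp_add, exp_pi_mul_I]
  ring

/-- Its `(2n+1)`-th power is `-1`, the exponent being odd. Hence the Lerch functions involved are
entire. -/
theorem neg_exp_ne_one (n j : ℕ) : -cexp (2 * I * Real.pi * j / (2 * n + 1)) ≠ 1 := by
  intro h
  have h0 : (2 * n + 1 : ℂ) ≠ 0 := by exact_mod_cast Nat.succ_ne_zero (2 * n)
  have hp := congrArg (· ^ (2 * n + 1)) h
  simp only [(odd_two_mul_add_one n).neg_pow, ← exp_nat_mul, one_pow] at hp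
  have : ((2 * n + 1 : ℕ) : ℂ) * (2 * I * Real.pi * j / (2 * n + 1)) = j * (2 * Real.pi * I) := by
    push_cast
    field_simp
  rw [this, exp_nat_mul, exp_two_pi_mul_I, one_pow] at hp
  norm_num at hp

theorem differentiable_lerchPhi_neg_exp (n j : ℕ) :
    Differentiable ℂ fun s => lerchPhi (-cexp (2 * I * Real.pi * j / (2 * n + 1))) s (n + 1) := by
  have h := neg_exp_ne_one n j
  rw [neg_exp_eq_exp_add_half] at h ⊢
  exact differentiable_lerchPhi_exp _ n h

theorem hasSum_lerchPhi_neg_exp (n j : ℕ) {s : ℂ} (hs : 1 < s.re) :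
    HasSum (fun k : ℕ => (-cexp (2 * I * Real.pi * j / (2 * n + 1))) ^ k *
        (n + 1 + k : ℂ) ^ (-s))
      (lerchPhi (-cexp (2 * I * Real.pi * j / (2 * n + 1))) s (n + 1)) := by
  have h := neg_exp_ne_one n j
  rw [neg_exp_eq_exp_add_half] at h ⊢
  exact hasSum_lerchPhi_exp _ n h hs

/-- The weights turn the alternating powers into powers of one root of unity. -/
theorem neg_one_pow_mul_exp_mul_neg_exp_pow (n j k : ℕ) :
    (-1 : ℂ) ^ j * cexp (I * Real.pi * j / (2 * n + 1)) *
        (-cexp (2 * I * Real.pi * j / (2 * n + 1))) ^ k =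
      (-1) ^ k * cexp (2 * Real.pi * I * j / (2 * n + 1 : ℕ)) ^ (k + (n + 1)) := by
  have h0 : (2 * n + 1 : ℂ) ≠ 0 := by exact_mod_cast Nat.succ_ne_zero (2 * n)
  have h1 : (-1 : ℂ) ^ j * cexp (I * Real.pi * j / (2 * n + 1)) =
      cexp (2 * Real.pi * I * j / (2 * n + 1 : ℕ)) ^ (n + 1) := by
    rw [← exp_pi_mul_I, ← exp_nat_mul, ← exp_nat_mul, ← exp_add]
    congr 1
    push_cast
    field_simp
    ring
  rw [h1, neg_pow, pow_add]
  push_cast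
  ring_nf

/-- The coefficients of the combined Dirichlet series, which live on the multiples of `2n + 1`. -/
theorem hasSum_ite_dvd_mul_natCast_cpow (n : ℕ) {s : ℂ} (hs : 1 < s.re) :
    HasSum (fun N : ℕ => (if 2 * n + 1 ∣ N then ((2 * n + 1 : ℕ) : ℂ) else 0) *
        ((-1) ^ (N + (n + 1)) * (N : ℂ) ^ (-s)))
      ((-1) ^ n * ((2 * n + 1 : ℕ) : ℂ) ^ (1 - s) * ((1 - 2 ^ (1 - s)) * riemannZeta s)) := by
  have h0 : ((2 * n + 1 : ℕ) : ℂ) ≠ 0 := by exact_mod_cast Nat.succ_ne_zero (2 * n)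
  have hinj : Function.Injective fun l : ℕ => (2 * n + 1) * l :=
    fun a b h => Nat.eq_of_mul_eq_mul_left (Nat.succ_pos _) h
  rw [← hinj.hasSum_iff]
  · have h := (hasSum_neg_one_pow_mul_natCast_cpow hs).mul_left
      ((-1) ^ (n + 1) * ((2 * n + 1 : ℕ) : ℂ) ^ (1 - s))
    convert! h using 1
    · funext l
      have hodd : (-1 : ℂ) ^ ((2 * n + 1) * l) = (-1) ^ l := by
        rw [pow_mul, (odd_two_mul_add_one n).neg_one_pow]
      rw [Function.comp_apply, if_pos (dvd_mul_right _ _), pow_add, hodd, Nat.cast_mul,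
        natCast_mul_natCast_cpow, sub_eq_add_neg 1 s, cpow_add _ _ h0, cpow_one]
      ring
    · ring
  · intro N hN
    rw [if_neg, zero_mul]
    rintro ⟨r, rfl⟩
    exact hN ⟨r, rfl⟩

theorem sum_lerchPhi_of_one_lt_re (n : ℕ) {s : ℂ} (hs : 1 < s.re) :
    ∑ j ∈ Finset.range (2 * n + 1), (-1 : ℂ) ^ j * cexp (I * Real.pi * j / (2 * n + 1)) *
        lerchPhi (-cexp (2 * I * Real.pi * j / (2 * n + 1))) s (n + 1) =
      (-1) ^ n * ((2 * n + 1 : ℕ) : ℂ) ^ (1 - s) * ((1 - 2 ^ (1 - s)) * riemannZeta s) := by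
  have hL := hasSum_sum (s := Finset.range (2 * n + 1)) fun j _ =>
    (hasSum_lerchPhi_neg_exp n j hs).mul_left
      ((-1 : ℂ) ^ j * cexp (I * Real.pi * j / (2 * n + 1)))
  have hR := (hasSum_nat_add_iff' (n + 1)).mpr (hasSum_ite_dvd_mul_natCast_cpow n hs)
  -- The discarded terms `N ≤ n` vanish: `0 ^ (-s) = 0`, and `0 < N < 2n + 1` is not divisible by
  -- `2n + 1`.
  rw [Finset.sum_eq_zero, sub_zero] at hR
  · refine hL.unique (hR.congr_fun fun k => ?_)
    simp only [← mul_assoc, neg_one_pow_mul_exp_mul_neg_exp_pow]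
    rw [← Finset.sum_mul, ← Finset.mul_sum, sum_range_exp_pow (2 * n + 1) _ (by omega),
      add_assoc k, pow_add _ k, ← two_mul, pow_mul, neg_one_sq, one_pow]
    push_cast
    ring_nf
  · intro N hN
    rcases Nat.eq_zero_or_pos N with rfl | hpos
    · simp [zero_cpow (neg_ne_zero.mpr (ne_zero_of_one_lt_re hs))]
    · rw [if_neg, zero_mul]
      intro hd
      have := Nat.le_of_dvd hpos hd
      have := Finset.mem_range.mp hN
      omega

/-- Both sides are holomorphic on the connected set `{1}ᶜ` and agree near `2`. -/
theorem sum_lerchPhi (n : ℕ) {s : ℂ} (hs : s ≠ 1) :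
    ∑ j ∈ Finset.range (2 * n + 1), (-1 : ℂ) ^ j * cexp (I * Real.pi * j / (2 * n + 1)) *
        lerchPhi (-cexp (2 * I * Real.pi * j / (2 * n + 1))) s (n + 1) =
      (-1) ^ n * ((2 * n + 1 : ℕ) : ℂ) ^ (1 - s) * ((1 - 2 ^ (1 - s)) * riemannZeta s) := by
  have h0 : ((2 * n + 1 : ℕ) : ℂ) ≠ 0 := by exact_mod_cast Nat.succ_ne_zero (2 * n)
  have hL : Differentiable ℂ fun s => ∑ j ∈ Finset.range (2 * n + 1),
      (-1 : ℂ) ^ j * cexp (I * Real.pi * j / (2 * n + 1)) *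
        lerchPhi (-cexp (2 * I * Real.pi * j / (2 * n + 1))) s (n + 1) :=
    Differentiable.fun_sum fun j _ => (differentiable_lerchPhi_neg_exp n j).const_mul _
  have hR : DifferentiableOn ℂ (fun s => (-1) ^ n * ((2 * n + 1 : ℕ) : ℂ) ^ (1 - s) *
      ((1 - 2 ^ (1 - s)) * riemannZeta s)) {1}ᶜ := by
    have hpow (c : ℂ) (hc : c ≠ 0) : DifferentiableOn ℂ (fun s : ℂ => c ^ (1 - s)) {1}ᶜ :=
      ((differentiable_id.const_sub 1).const_cpow (Or.inl hc)).differentiableOn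
    exact ((hpow _ h0).const_mul _).mul
      (((hpow 2 two_ne_zero).const_sub 1).mul differentiableOn_riemannZeta)
  refine AnalyticOnNhd.eqOn_of_preconnected_of_eventuallyEq
    (hL.differentiableOn.analyticOnNhd isOpen_compl_singleton)
    (hR.analyticOnNhd isOpen_compl_singleton)
    (isConnected_compl_singleton_of_one_lt_rank (by simp) 1).isPreconnected
    (show (2 : ℂ) ∈ ({1}ᶜ : Set ℂ) by simp) ?_ hs
  have hU : {s : ℂ | 1 < s.re} ∈ 𝓝 (2 : ℂ) :=
    (isOpen_lt continuous_const continuous_re).mem_nhds (by simp)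
  filter_upwards [hU] with t ht
  exact sum_lerchPhi_of_one_lt_re n ht

/-! ### Differentiation at `-1` -/

theorem riemannZeta_neg_one : riemannZeta (-1) = -1 / 12 := by
  have h := riemannZeta_neg_nat_eq_bernoulli' 1
  norm_num [bernoulli'_two] at h
  rw [h]
  norm_num

/-- The derivative at `-1` of `m ^ (1 - s) * (1 - 2 ^ (1 - s)) * ζ(s)`. -/
theorem hasDerivAt_cpow_mul_eta_neg_one (m : ℕ) (hm : m ≠ 0) :
    HasDerivAt (fun s => (m : ℂ) ^ (1 - s) * ((1 - 2 ^ (1 - s)) * riemannZeta s))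
      ((m ^ 2 * (3 * Real.log glaisherA - 1 / 4 - Real.log 2 / 3 - Real.log m / 4) : ℝ) : ℂ)
      (-1) := by
  have hm' : (m : ℂ) ≠ 0 := by exact_mod_cast hm
  have hid := (hasDerivAt_id (-1 : ℂ)).const_sub 1
  have hz := (differentiableAt_riemannZeta (by norm_num : (-1 : ℂ) ≠ 1)).hasDerivAt
  rw [glaisherA_pos_and_deriv_riemannZeta_neg_one.2] at hz
  -- At `-1` the factor `1 - 2^{1-s}` has value `-3` and derivative `4 log 2`.
  refine ((hid.const_cpow (Or.inl hm')).mul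
    (((hid.const_cpow (Or.inl two_ne_zero)).const_sub 1).mul hz)).congr_deriv ?_
  have l2 : Complex.log 2 = ((Real.log 2 : ℝ) : ℂ) := by
    rw [ofReal_log zero_le_two, ofReal_ofNat]
  simp only [id, riemannZeta_neg_one, sub_neg_eq_add, show (1 + 1 : ℂ) = 2 by norm_num,
    cpow_ofNat, ← natCast_log, l2, Pi.mul_apply]
  push_cast
  ring

theorem mainTheorem6 (n : ℕ) (hn : 1 ≤ n) :
    (∀ j ∈ Finset.range (2 * n + 1),
      DifferentiableAt ℂ
        (fun s : ℂ =>
          lerchPhi (-Complex.exp (2 * Complex.I * Real.pi * j / (2 * n + 1))) s (n + 1)) (-1)) ∧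
    ∑ j ∈ Finset.range (2 * n + 1),
        (-1 : ℂ) ^ j * Complex.exp (Complex.I * Real.pi * j / (2 * n + 1)) *
          deriv
            (fun s : ℂ =>
              lerchPhi (-Complex.exp (2 * Complex.I * Real.pi * j / (2 * n + 1))) s (n + 1)) (-1)
      = (((1 / 8 : ℝ) * (-1) ^ n * (2 * n + 1) ^ 2 *
          Real.log (glaisherA ^ 24 /
            (4 * (2 : ℝ) ^ (2 / 3 : ℝ) * Real.exp 1 ^ 2 * (2 * n + 1) ^ 2)) : ℝ) : ℂ) := by
  refine ⟨fun j _ => differentiable_lerchPhi_neg_exp n j _, ?_⟩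
  have hsum := HasDerivAt.fun_sum (u := Finset.range (2 * n + 1)) fun j _ =>
    ((differentiable_lerchPhi_neg_exp n j (-1)).hasDerivAt).const_mul
      ((-1 : ℂ) ^ j * cexp (I * Real.pi * j / (2 * n + 1)))
  have heta := (hasDerivAt_cpow_mul_eta_neg_one (2 * n + 1) (Nat.succ_ne_zero _)).const_mul
    ((-1 : ℂ) ^ n)
  have hne : {(1 : ℂ)}ᶜ ∈ 𝓝 (-1 : ℂ) := isOpen_compl_singleton.mem_nhds (by norm_num)
  have heq := heta.congr_of_eventuallyEq (f₁ := fun s => ∑ j ∈ Finset.range (2 * n + 1),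
      (-1 : ℂ) ^ j * cexp (I * Real.pi * j / (2 * n + 1)) *
        lerchPhi (-cexp (2 * I * Real.pi * j / (2 * n + 1))) s (n + 1))
    (by filter_upwards [hne] with s hs
        rw [sum_lerchPhi n hs, mul_assoc])
  have hA := glaisherA_pos_and_deriv_riemannZeta_neg_one.1
  -- Here `8/3 = 2 + 2/3` comes from `4 · 2^{2/3}`; one eighth of the right side is the bracket in
  -- `hasDerivAt_cpow_mul_eta_neg_one`.
  have hlog : Real.log (glaisherA ^ 24 /
      (4 * (2 : ℝ) ^ (2 / 3 : ℝ) * Real.exp 1 ^ 2 * (2 * n + 1) ^ 2)) =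
      24 * Real.log glaisherA - 2 - 8 / 3 * Real.log 2 - 2 * Real.log (2 * n + 1) := by
    rw [show (4 : ℝ) = 2 ^ 2 by norm_num, Real.log_div (by positivity) (by positivity),
      Real.log_mul (by positivity) (by positivity), Real.log_mul (by positivity) (by positivity),
      Real.log_mul (by positivity) (by positivity), Real.log_rpow two_pos]
    simp only [Real.log_pow, Real.log_exp]
    push_cast
    ring
  rw [hsum.unique heq, hlog]
  push_cast
  ring
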